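/- Let $n$ and $m$ be integers with $n > 2$ and $m \ge 0$. Then $$2^n + n \ne \frac{m(m+1)}{2} \qquad\text{and}\qquad 2^n - n \ne \frac{m(m+1)}{2}.$$ That is, for every integer $n > 2$, neither $2^n + n$ nor $2^n - n$ is a triangular number. -/

import Mathlib

open Finset

/-! With x = 2m + 1 the equations become x² = 2^(n+3) + 1 ± 8n. If n + 3 = 2k, the right side lies
strictly between consecutive squares, apart from small k, which are checked directly.

If n + 3 = 2j + 1, a solution makes x / 2^j approximate √2 to within 16j / 4^j
(`abs_div_sub_sqrt_two_le`), and Padé approximation rules this out for large j. As 181² = 2^15 - 7,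
√2 is a rational multiple of (1 - 7/2^15)^(-1/2), and the [2c/5c] approximant gives integers a, b
with 2^(51c+7) √2 a - 181 b = ε, where 0 < ε ≤ 1/2 has an explicit lower bound (`remainder_bounds`).
Replacing √2 by x / 2^j, with j ≤ 51c + 7, changes the left side by less than ε (`error_bound`) and
makes it an integer strictly between 0 and 1. This covers j ≥ 1691; smaller j are settled by
computation. -/

/-! ### Generalized binomial coefficients. -/

/-- The generalized binomial coefficient `r (r - 1) ⋯ (r - k + 1) / k!` of a real number. -/
noncomputable def rchoose (r : ℝ) : ℕ → ℝ
  | 0 => 1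
  | k + 1 => rchoose r k * (r - k) / (k + 1)

theorem rchoose_zero (r : ℝ) : rchoose r 0 = 1 := rfl

theorem succ_mul_rchoose_succ (r : ℝ) (k : ℕ) :
    ((k : ℝ) + 1) * rchoose r (k + 1) = (r - k) * rchoose r k := by
  have : (k : ℝ) + 1 ≠ 0 := by positivity
  rw [rchoose]
  field_simp

theorem succ_mul_rchoose_succ' (r : ℝ) (k : ℕ) :
    ((k : ℝ) + 1) * rchoose r (k + 1) = r * rchoose (r - 1) k := by
  induction k generalizing r with
  | zero => simp [rchoose]
  | succ k ih =>
    have h0 : (k : ℝ) + 1 ≠ 0 := by positivity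
    have h1 := succ_mul_rchoose_succ r (k + 1)
    have h2 := succ_mul_rchoose_succ (r - 1) k
    have h3 := ih r
    push_cast at *
    apply mul_left_cancel₀ h0
    linear_combination ((k : ℝ) + 1) * h1 + (r - (k + 1)) * h3 - r * h2

theorem rchoose_succ_succ (r : ℝ) (k : ℕ) :
    rchoose (r + 1) (k + 1) = rchoose r (k + 1) + rchoose r k := by
  have h0 : (k : ℝ) + 1 ≠ 0 := by positivity
  have h1 := succ_mul_rchoose_succ r k
  have h2 := succ_mul_rchoose_succ' (r + 1) k
  rw [add_sub_cancel_right] at h2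
  apply mul_left_cancel₀ h0
  linear_combination h2 - h1

theorem factorial_mul_rchoose (r : ℝ) (k : ℕ) :
    (k.factorial : ℝ) * rchoose r k = ∏ i ∈ range k, (r - i) := by
  induction k with
  | zero => simp [rchoose]
  | succ k ih =>
    rw [prod_range_succ, ← ih, Nat.factorial_succ]
    push_cast
    linear_combination (k.factorial : ℝ) * succ_mul_rchoose_succ r k

/-- The integer `4 ^ k * rchoose (m - 1 / 2) k`. -/
def halfChoose : ℕ → ℕ → ℤ
  | 0, k => (-1) ^ k * Nat.centralBinom k
  | _ + 1, 0 => 1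
  | m + 1, k + 1 => halfChoose m (k + 1) + 4 * halfChoose m k

/-- Shows that 4^k clears the denominator: central binomial coefficients give the case m = 0, and
Pascal's rule raises m. -/
theorem halfChoose_eq (m k : ℕ) :
    (halfChoose m k : ℝ) = 4 ^ k * rchoose (m - 1 / 2) k := by
  induction m generalizing k with
  | zero =>
    induction k with
    | zero => simp [halfChoose, rchoose]
    | succ k ih =>
      have h0 : (k : ℝ) + 1 ≠ 0 := by positivity
      have h1 := succ_mul_rchoose_succ (((0 : ℕ) : ℝ) - 1 / 2) k
      have h2 : ((k : ℝ) + 1) * Nat.centralBinom (k + 1)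
          = 2 * (2 * k + 1) * Nat.centralBinom k := by
        exact_mod_cast Nat.succ_mul_centralBinom_succ k
      simp only [halfChoose] at ih ⊢
      push_cast at *
      apply mul_left_cancel₀ h0
      linear_combination (-1) ^ (k + 1) * h2 - 4 ^ (k + 1) * h1 - 2 * (2 * (k : ℝ) + 1) * ih
  | succ m ih =>
    cases k with
    | zero => simp [halfChoose, rchoose]
    | succ k =>
      have h := rchoose_succ_succ (m - 1 / 2) k
      have h' : ((m + 1 : ℕ) : ℝ) - 1 / 2 = m - 1 / 2 + 1 := by push_cast; ring
      rw [h', h, halfChoose]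
      push_cast
      rw [ih, ih]
      ring

theorem rchoose_half_bounds (q k : ℕ) (hk : k ≤ q + 1) :
    0 ≤ rchoose (q + 1 / 2) k ∧ rchoose (q + 1 / 2) k ≤ (q + 1).choose k := by
  induction k with
  | zero => simp [rchoose]
  | succ k ih =>
    obtain ⟨h1, h2⟩ := ih (by omega)
    have hkq : (k : ℝ) ≤ q := by exact_mod_cast (by omega : k ≤ q)
    have h0 : (0 : ℝ) < (k : ℝ) + 1 := by positivity
    have h3 := succ_mul_rchoose_succ (q + 1 / 2) k
    have h4 : (((q + 1).choose (k + 1) : ℕ) : ℝ) * (k + 1) = (q + 1).choose k * (q + 1 - k) := by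
      have := Nat.choose_succ_right_eq (q + 1) k
      have h5 : ((q + 1 - k : ℕ) : ℝ) = q + 1 - k := by
        rw [Nat.cast_sub (by omega)]; push_cast; ring
      rw [← h5]
      exact_mod_cast this
    constructor
    · refine le_of_mul_le_mul_left ?_ h0
      rw [h3, mul_zero]
      exact mul_nonneg (by linarith) h1
    · refine le_of_mul_le_mul_left ?_ h0
      rw [h3, mul_comm ((k : ℝ) + 1), h4, mul_comm]
      exact mul_le_mul h2 (by linarith) (by linarith) (by positivity)

/-! ### Padé approximants to (1 - t)^ν and their remainder. -/

/-- The numerator of degree `p` of the `[p/q]` Padé approximant to `(1 - t) ^ ν` at `0`. -/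
noncomputable def padeNum (p q : ℕ) (ν t : ℝ) : ℝ :=
  ∑ k ∈ range (p + 1), rchoose (q + ν) k * (p + q - k).choose q * (-t) ^ k

/-- The denominator of degree `q` of the `[p/q]` Padé approximant to `(1 - t) ^ ν` at `0`. -/
noncomputable def padeDen (p q : ℕ) (ν t : ℝ) : ℝ :=
  ∑ k ∈ range (q + 1), rchoose (p - ν) k * (p + q - k).choose p * (-t) ^ k

/-- The remainder of the Padé approximation, divided by `(1 - t) ^ ν`. -/
noncomputable def padeRem (p q : ℕ) (ν t : ℝ) : ℝ :=
  (1 - t) ^ (-ν) * padeNum p q ν t - padeDen p q ν t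

theorem sum_neg_pow_zero (n : ℕ) (a : ℕ → ℝ) :
    ∑ k ∈ range (n + 1), a k * (-(0 : ℝ)) ^ k = a 0 := by
  rw [sum_range_succ', sum_eq_zero]
  · simp
  · intro k _
    simp

theorem padeRem_zero (p q : ℕ) (ν : ℝ) : padeRem p q ν 0 = 0 := by
  rw [padeRem, padeNum, padeDen, sum_neg_pow_zero p (fun k => rchoose (q + ν) k * (p + q - k).choose q),
    sum_neg_pow_zero q (fun k => rchoose (p - ν) k * (p + q - k).choose p)]
  simp only [rchoose_zero, tsub_zero, Real.one_rpow, one_mul]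
  rw [Nat.choose_symm_add, sub_self]

theorem hasDerivAt_sum_neg_pow (n : ℕ) (a : ℕ → ℝ) (t : ℝ) :
    HasDerivAt (fun t : ℝ => ∑ k ∈ range (n + 1), a k * (-t) ^ k)
      (-∑ k ∈ range n, (k + 1) * a (k + 1) * (-t) ^ k) t := by
  have h : ∀ k ∈ range (n + 1),
      HasDerivAt (fun t : ℝ => a k * (-t) ^ k) (a k * (k * (-t) ^ (k - 1) * (-1))) t :=
    fun k _ => (((hasDerivAt_id t).neg).pow k).const_mul (a k)
  refine (HasDerivAt.fun_sum h).congr_deriv ?_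
  symm
  rw [sum_range_succ', ← sum_neg_distrib]
  simp only [Nat.cast_zero, zero_mul, mul_zero, add_zero]
  refine sum_congr rfl fun k _ => ?_
  push_cast
  ring

/-- The factor (1 - t)^(-(ν+1)) is pulled out so that differentiation appears as ν ↦ ν + 1. -/
theorem hasDerivAt_rpow_mul_sum (n : ℕ) (a : ℕ → ℝ) (ν t : ℝ) (ht : t < 1) :
    HasDerivAt (fun t : ℝ => (1 - t) ^ (-ν) * ∑ k ∈ range (n + 1), a k * (-t) ^ k)
      ((1 - t) ^ (-(ν + 1)) * (∑ k ∈ range n, ((ν - k) * a k - (k + 1) * a (k + 1)) * (-t) ^ k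
        + (ν - n) * a n * (-t) ^ n)) t := by
  have h1 : HasDerivAt (fun t : ℝ => (1 - t) ^ (-ν)) (-1 * (-ν) * (1 - t) ^ (-ν - 1)) t :=
    ((hasDerivAt_id t).const_sub 1).rpow_const (Or.inl (by simp; linarith))
  refine (h1.mul (hasDerivAt_sum_neg_pow n a t)).congr_deriv ?_
  symm
  have h2 : (1 - t) ^ (-ν) = (1 - t) ^ (-(ν + 1)) * (1 - t) := by
    rw [← Real.rpow_add_one (by linarith)]; congr 1; ring
  have h3 : -ν - 1 = -(ν + 1) := by ring
  have h4 : (1 - t) * ∑ k ∈ range n, (k + 1) * a (k + 1) * (-t) ^ k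
      = ∑ k ∈ range n, (k + 1) * a (k + 1) * (-t) ^ k
        + ∑ k ∈ range (n + 1), k * a k * (-t) ^ k := by
    rw [sum_range_succ', sub_mul, one_mul, sub_eq_add_neg, mul_sum, ← sum_neg_distrib]
    congr 1
    simp only [Nat.cast_zero, zero_mul, add_zero]
    refine sum_congr rfl fun k _ => ?_
    push_cast
    ring
  rw [h2, h3, mul_assoc ((1 - t) ^ (-(ν + 1))) (1 - t), mul_neg (1 - t), h4, sum_range_succ, sum_range_succ]
  simp only [sub_mul, sum_sub_distrib, mul_assoc, ← mul_sum]
  ring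

/-- For q = 0 the numerator is a truncated binomial series, so every coefficient of the derivative
below degree p cancels. -/
theorem hasDerivAt_padeRem_zero (p : ℕ) (ν t : ℝ) (ht : t < 1) :
    HasDerivAt (padeRem p 0 ν)
      ((ν - p) * rchoose ν p * (-1) ^ p * (1 - t) ^ (-(ν + 1)) * t ^ p) t := by
  have h := (hasDerivAt_rpow_mul_sum p (rchoose ν) ν t ht).sub_const 1
  have hf : padeRem p 0 ν
      = fun t => (1 - t) ^ (-ν) * ∑ k ∈ range (p + 1), rchoose ν k * (-t) ^ k - 1 := by
    funext t
    simp [padeRem, padeNum, padeDen, rchoose_zero]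
  rw [hf]
  refine h.congr_deriv ?_
  symm
  rw [sum_eq_zero, neg_pow t]
  · ring
  · intro k _
    rw [succ_mul_rchoose_succ, sub_self, zero_mul]

/-- Numerator and denominator parts both acquire the factor ν - p, so remainders differentiate to
remainders; this drives the induction on q. -/
theorem hasDerivAt_padeRem_succ (p q : ℕ) (ν t : ℝ) (ht : t < 1) :
    HasDerivAt (padeRem p (q + 1) ν) ((ν - p) * padeRem p q (ν + 1) t) t := by
  have h := (hasDerivAt_rpow_mul_sum p
    (fun k => rchoose ((q + 1 : ℕ) + ν) k * (p + (q + 1) - k).choose (q + 1)) ν t ht).sub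
    (hasDerivAt_sum_neg_pow (q + 1)
      (fun k => rchoose (p - ν) k * (p + (q + 1) - k).choose p) t)
  refine HasDerivAt.congr_deriv h ?_
  have hA : (∑ k ∈ range p, ((ν - k) * (rchoose ((q + 1 : ℕ) + ν) k *
        (p + (q + 1) - k).choose (q + 1)) - (k + 1) * (rchoose ((q + 1 : ℕ) + ν) (k + 1) *
        (p + (q + 1) - (k + 1)).choose (q + 1))) * (-t) ^ k
        + (ν - p) * (rchoose ((q + 1 : ℕ) + ν) p * (p + (q + 1) - p).choose (q + 1)) * (-t) ^ p)
      = (ν - p) * padeNum p q (ν + 1) t := by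
    rw [padeNum, sum_range_succ, mul_add, mul_sum]
    have hr : ((q + 1 : ℕ) : ℝ) + ν = q + (ν + 1) := by push_cast; ring
    rw [hr]
    congr 1
    · refine sum_congr rfl fun k hk => ?_
      obtain ⟨s, rfl⟩ := Nat.exists_eq_add_of_lt (mem_range.1 hk)
      have e1 : k + s + 1 + (q + 1) - k = q + s + 1 + 1 := by omega
      have e2 : k + s + 1 + (q + 1) - (k + 1) = q + s + 1 := by omega
      have e3 : k + s + 1 + q - k = q + s + 1 := by omega
      have h1 := succ_mul_rchoose_succ (q + (ν + 1)) k
      have h2 : ((q + s + 1 + 1).choose (q + 1) : ℝ)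
          = (q + s + 1).choose q + (q + s + 1).choose (q + 1) := by
        exact_mod_cast Nat.choose_succ_succ _ _
      have h3 : ((q + s + 1).choose (q + 1) : ℝ) * (q + 1) = (q + s + 1).choose q * (s + 1) := by
        have := Nat.choose_succ_right_eq (q + s + 1) q
        rw [show q + s + 1 - q = s + 1 by omega] at this
        exact_mod_cast this
      rw [e1, e2, e3, h2]
      push_cast
      linear_combination (-t) ^ k * (-((q + s + 1).choose (q + 1) : ℝ) * h1
        - rchoose (q + (ν + 1)) k * h3)
    · rw [show p + (q + 1) - p = q + 1 by omega, show p + q - p = q by omega]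
      simp
      ring
  have hB : -∑ k ∈ range (q + 1), ((k : ℝ) + 1) * (rchoose (p - ν) (k + 1) *
        (p + (q + 1) - (k + 1)).choose p) * (-t) ^ k
      = -(ν - p) * -padeDen p q (ν + 1) t := by
    rw [padeDen, neg_mul_neg, mul_sum, ← sum_neg_distrib]
    refine sum_congr rfl fun k _ => ?_
    have h1 := succ_mul_rchoose_succ' (p - ν) k
    rw [show p + (q + 1) - (k + 1) = p + q - k by omega,
      show (p : ℝ) - (ν + 1) = p - ν - 1 by ring]
    linear_combination (-((p + q - k).choose p : ℝ)) * (-t) ^ k * h1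
  rw [hA, hB, padeRem]
  ring

/-- Cauchy's mean value theorem, comparing f with s^(m+1). -/
theorem exists_eq_mul_pow_of_hasDerivAt {f θ : ℝ → ℝ} {K t : ℝ} {m : ℕ} (ht : 0 < t)
    (hf0 : f 0 = 0) (hc : ContinuousOn f (Set.Icc 0 t))
    (hf : ∀ s ∈ Set.Ioo 0 t, HasDerivAt f (K * θ s * s ^ m) s) :
    ∃ s ∈ Set.Ioo 0 t, f t = K / (m + 1) * θ s * t ^ (m + 1) := by
  obtain ⟨s, hs, h⟩ := exists_ratio_hasDerivAt_eq_ratio_slope f _ ht hc hf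
    (fun x => x ^ (m + 1)) (fun x => ((m + 1 : ℕ) : ℝ) * x ^ m) (by fun_prop)
    (fun x _ => by simpa using hasDerivAt_pow (m + 1) x)
  refine ⟨s, hs, ?_⟩
  have h0 : s ^ m ≠ 0 := (pow_pos hs.1 m).ne'
  have h1 : (m : ℝ) + 1 ≠ 0 := by positivity
  rw [hf0] at h
  push_cast at h
  simp only [ne_eq, Nat.add_eq_zero_iff, one_ne_zero, and_false, not_false_eq_true, zero_pow,
    sub_zero] at h
  have h2 : K / (m + 1) * (m + 1) = K := div_mul_cancel₀ K h1
  apply mul_left_cancel₀ (mul_ne_zero h1 h0)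
  linear_combination -h - t ^ (m + 1) * θ s * s ^ m * h2

/-- The leading coefficient of `padeRem`. -/
noncomputable def padeConst (p : ℕ) : ℕ → ℝ → ℝ
  | 0, ν => (ν - p) * rchoose ν p * (-1) ^ p / (p + 1)
  | q + 1, ν => (ν - p) * padeConst p q (ν + 1) / (p + q + 1 + 1)

theorem padeRem_eq (p q : ℕ) {ν z t : ℝ} (hν : 0 ≤ ν) (hz : z < 1) (ht : 0 < t) (htz : t ≤ z) :
    ∃ θ : ℝ, 1 ≤ θ ∧ θ ≤ (1 - z) ^ (-(ν + q + 1)) ∧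
      padeRem p q ν t = padeConst p q ν * θ * t ^ (p + q + 1) := by
  induction q generalizing ν t with
  | zero =>
    obtain ⟨s, hs, h⟩ := exists_eq_mul_pow_of_hasDerivAt (f := padeRem p 0 ν)
      (θ := fun s => (1 - s) ^ (-(ν + 1))) (K := (ν - p) * rchoose ν p * (-1) ^ p) (m := p)
      ht (padeRem_zero p 0 ν)
      (fun s hs => (hasDerivAt_padeRem_zero p ν s (by linarith [hs.2])).continuousAt.continuousWithinAt)
      (fun s hs => hasDerivAt_padeRem_zero p ν s (by linarith [hs.2]))
    refine ⟨_, ?_, ?_, h⟩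
    · exact Real.one_le_rpow_of_pos_of_le_one_of_nonpos (by linarith [hs.2]) (by linarith [hs.1])
        (by linarith)
    · simp only [Nat.cast_zero, add_zero]
      exact Real.rpow_le_rpow_of_nonpos (by linarith) (by linarith [hs.2]) (by linarith)
  | succ q ih =>
    have hex : ∀ s : ℝ, ∃ θ : ℝ, s ∈ Set.Ioo 0 t → 1 ≤ θ ∧ θ ≤ (1 - z) ^ (-(ν + 1 + q + 1)) ∧
        padeRem p q (ν + 1) s = padeConst p q (ν + 1) * θ * s ^ (p + q + 1) := by
      intro s
      by_cases hs : s ∈ Set.Ioo 0 t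
      · obtain ⟨θ, h⟩ := ih (ν := ν + 1) (t := s) (by linarith) hs.1 (by linarith [hs.2])
        exact ⟨θ, fun _ => h⟩
      -- Junk value: `θ` is only used inside the interval.
      · exact ⟨0, fun h => absurd h hs⟩
    choose θ hθ using hex
    obtain ⟨s, hs, h⟩ := exists_eq_mul_pow_of_hasDerivAt (f := padeRem p (q + 1) ν)
      (θ := θ) (K := (ν - p) * padeConst p q (ν + 1)) (m := p + q + 1)
      ht (padeRem_zero p _ ν)
      (fun s hs => (hasDerivAt_padeRem_succ p q ν s
        (by linarith [hs.2])).continuousAt.continuousWithinAt)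
      (fun s hs => by
        have := hasDerivAt_padeRem_succ p q ν s (by linarith [hs.2])
        rw [(hθ s hs).2.2] at this
        convert this using 1
        ring)
    refine ⟨θ s, (hθ s hs).1, ?_, ?_⟩
    · convert (hθ s hs).2.1 using 2
      push_cast
      ring
    · rw [h, padeConst]
      push_cast
      ring

/-! ### Sizes of the leading coefficient and the numerator at ν = 1/2. -/

theorem factorial_mul_padeConst (p q : ℕ) (ν : ℝ) :
    ((p + q + 1).factorial : ℝ) * padeConst p q ν
      = (-1) ^ p * (∏ i ∈ range (q + 1), (ν + i - p)) * ∏ i ∈ range p, (ν + q - i) := by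
  induction q generalizing ν with
  | zero =>
    have h := factorial_mul_rchoose ν p
    have h0 : (p : ℝ) + 1 ≠ 0 := by positivity
    simp only [padeConst, add_zero, zero_add, prod_range_one, Nat.cast_zero, ← h,
      Nat.factorial_succ]
    push_cast
    field_simp
  | succ q ih =>
    have h := ih (ν + 1)
    have h0 : (p : ℝ) + q + 1 + 1 ≠ 0 := by positivity
    have e1 : ∏ i ∈ range (q + 1), (ν + ((i + 1 : ℕ) : ℝ) - p)
        = ∏ i ∈ range (q + 1), (ν + 1 + i - p) :=
      prod_congr rfl fun i _ => by push_cast; ring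
    have e2 : ∏ i ∈ range p, (ν + ((q + 1 : ℕ) : ℝ) - i) = ∏ i ∈ range p, (ν + 1 + q - i) :=
      prod_congr rfl fun i _ => by push_cast; ring
    rw [prod_range_succ', e1, e2, show p + (q + 1) + 1 = (p + q + 1) + 1 by ring,
      Nat.factorial_succ, padeConst]
    push_cast
    field_simp
    linear_combination (ν - p) * h

/-- The product `(1/2) (3/2) ⋯ (m - 1/2)`. -/
noncomputable def halfFactorial (m : ℕ) : ℝ := ∏ i ∈ range m, ((i : ℝ) + 1 / 2)

theorem halfFactorial_le (m : ℕ) : halfFactorial m ≤ m.factorial := by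
  rw [← prod_range_add_one_eq_factorial, halfFactorial]
  push_cast
  exact prod_le_prod (fun i _ => by positivity) (fun i _ => by linarith)

theorem halfFactorial_pos (m : ℕ) : 0 < halfFactorial m :=
  prod_pos fun i _ => by positivity

theorem le_halfFactorial_succ (m : ℕ) : (m.factorial : ℝ) / 2 ≤ halfFactorial (m + 1) := by
  rw [← prod_range_add_one_eq_factorial, halfFactorial, prod_range_succ']
  push_cast
  have : ∏ i ∈ range m, ((i : ℝ) + 1) ≤ ∏ i ∈ range m, ((i : ℝ) + 1 + 1 / 2) :=
    prod_le_prod (fun i _ => by positivity) (fun i _ => by linarith)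
  linarith

theorem prod_range_add_half (q p : ℕ) (h : p ≤ q) :
    halfFactorial (q + 1) = halfFactorial (q + 1 - p) * ∏ i ∈ range p, (1 / 2 + (q : ℝ) - i) := by
  rw [halfFactorial, halfFactorial, ← prod_range_mul_prod_Ico _ (show q + 1 - p ≤ q + 1 by omega)]
  congr 1
  rw [prod_Ico_eq_prod_range, show q + 1 - (q + 1 - p) = p by omega, ← prod_range_reflect]
  refine prod_congr rfl fun i hi => ?_
  have hi := mem_range.1 hi
  have : q + 1 - p + (p - 1 - i) = q - i := by omega
  rw [this, Nat.cast_sub (by omega)]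
  ring

/-- The sign (-1)^p cancels against the p negative factors 1/2 + i - p with i < p, so the constant
is positive. -/
theorem factorial_mul_padeConst_half (p q : ℕ) (h : p ≤ q) :
    ((p + q + 1).factorial : ℝ) * padeConst p q (1 / 2)
      = halfFactorial p * halfFactorial (q + 1) := by
  rw [factorial_mul_padeConst, prod_range_add_half q p h, ← mul_assoc]
  congr 1
  rw [← prod_range_mul_prod_Ico _ (show p ≤ q + 1 by omega), ← mul_assoc]
  congr 1
  · rw [← prod_range_reflect, halfFactorial]
    have : ((-1 : ℝ)) ^ p = ∏ i ∈ range p, (-1) := by simp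
    rw [this, ← prod_mul_distrib]
    refine prod_congr rfl fun i hi => ?_
    have hi := mem_range.1 hi
    rw [Nat.cast_sub (by omega), Nat.cast_sub (by omega)]
    push_cast
    ring
  · rw [prod_Ico_eq_prod_range, halfFactorial]
    refine prod_congr rfl fun i _ => ?_
    push_cast
    ring

theorem padeConst_half_le_one (p q : ℕ) (h : p ≤ q) : padeConst p q (1 / 2) ≤ 1 := by
  have h0 : (0 : ℝ) < (p + q + 1).factorial := by positivity
  refine le_of_mul_le_mul_left ?_ h0
  rw [factorial_mul_padeConst_half p q h, mul_one]
  calc halfFactorial p * halfFactorial (q + 1) ≤ p.factorial * (q + 1).factorial :=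
        mul_le_mul (halfFactorial_le p) (halfFactorial_le _) (halfFactorial_pos _).le (by positivity)
    _ ≤ (p + q + 1).factorial := by
        exact_mod_cast Nat.le_of_dvd (Nat.factorial_pos _) (Nat.factorial_mul_factorial_dvd_factorial_add p (q + 1))

theorem one_le_padeConst_half (p q : ℕ) (hp : 0 < p) (h : p ≤ q) :
    1 ≤ 4 * p * (p + q + 1) * (p + q).choose q * padeConst p q (1 / 2) := by
  obtain ⟨r, rfl⟩ := Nat.exists_eq_succ_of_ne_zero hp.ne'
  have h1 := factorial_mul_padeConst_half (r + 1) q h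
  have h2 : ((r.factorial : ℝ) / 2) * (q.factorial / 2) ≤ halfFactorial (r + 1) * halfFactorial (q + 1) :=
    mul_le_mul (le_halfFactorial_succ r) (le_halfFactorial_succ q) (by positivity)
      (halfFactorial_pos _).le
  have h3 : ((r + 1 + q).choose q : ℝ) * ((r + 1) * r.factorial) * q.factorial
      = (r + 1 + q).factorial := by
    have := Nat.add_choose_mul_factorial_mul_factorial (r + 1) q
    rw [Nat.factorial_succ r] at this
    exact_mod_cast this
  rw [← h1, Nat.factorial_succ, Nat.cast_mul, ← h3] at h2
  have h4 : (0 : ℝ) < r.factorial * q.factorial := by positivity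
  refine le_of_mul_le_mul_left ?_ h4
  push_cast at h2 ⊢
  linarith

theorem abs_padeNum_half_le (p q : ℕ) (h : p ≤ q) {t : ℝ} (ht : 0 ≤ t) :
    |padeNum p q (1 / 2) t| ≤ (p + q).choose q * (1 + t) ^ (q + 1) := by
  calc |padeNum p q (1 / 2) t|
      ≤ ∑ k ∈ range (p + 1), |rchoose (q + 1 / 2) k * (p + q - k).choose q * (-t) ^ k| :=
        abs_sum_le_sum_abs _ _
    _ ≤ ∑ k ∈ range (p + 1), ((p + q).choose q : ℝ) * (t ^ k * (q + 1).choose k) := by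
        refine sum_le_sum fun k hk => ?_
        have hk := mem_range.1 hk
        obtain ⟨h1, h2⟩ := rchoose_half_bounds q k (by omega)
        have h3 : ((p + q - k).choose q : ℝ) ≤ (p + q).choose q := by
          exact_mod_cast Nat.choose_le_choose q (Nat.sub_le _ _)
        rw [abs_mul, abs_mul, abs_pow, abs_neg, abs_of_nonneg ht, abs_of_nonneg h1, Nat.abs_cast]
        calc rchoose (q + 1 / 2) k * (p + q - k).choose q * t ^ k
            ≤ (q + 1).choose k * (p + q).choose q * t ^ k := by gcongr
          _ = _ := by ring
    _ ≤ ∑ k ∈ range (q + 1 + 1), ((p + q).choose q : ℝ) * (t ^ k * (q + 1).choose k) :=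
        sum_le_sum_of_subset_of_nonneg (range_subset_range.2 (by omega))
          (fun _ _ _ => by positivity)
    _ = (p + q).choose q * (1 + t) ^ (q + 1) := by
        rw [← mul_sum, add_comm 1 t, add_pow]
        simp

/-! ### Integrality and the value at t = 7/2^15. -/

theorem exists_int_sum_half (n m : ℕ) (b : ℕ → ℕ) :
    ∃ a : ℤ, (a : ℝ) = 2 ^ (17 * n) *
      ∑ k ∈ range (n + 1), rchoose (m - 1 / 2) k * b k * (-(7 / 2 ^ 15)) ^ k := by
  refine ⟨∑ k ∈ range (n + 1), halfChoose m k * b k * (-7) ^ k * 2 ^ (17 * (n - k)), ?_⟩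
  push_cast
  rw [mul_sum]
  refine sum_congr rfl fun k hk => ?_
  obtain ⟨s, rfl⟩ := Nat.exists_eq_add_of_le (Nat.lt_succ_iff.1 (mem_range.1 hk))
  rw [halfChoose_eq, Nat.add_sub_cancel_left, neg_pow, neg_pow (7 / 2 ^ 15 : ℝ), div_pow, mul_add,
    pow_add, pow_mul, pow_mul]
  -- Each power of t costs 2^15, and each half-integer binomial index another 4.
  have : (2 : ℝ) ^ 17 = 4 * 2 ^ 15 := by norm_num
  rw [this, mul_pow 4 _ k]
  field_simp

theorem exists_int_padeNum (p q : ℕ) :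
    ∃ a : ℤ, (a : ℝ) = 2 ^ (17 * p) * padeNum p q (1 / 2) (7 / 2 ^ 15) := by
  obtain ⟨a, ha⟩ := exists_int_sum_half p (q + 1) (fun k => (p + q - k).choose q)
  refine ⟨a, ?_⟩
  rw [ha, padeNum]
  congr! 5
  push_cast
  ring

theorem exists_int_padeDen (p q : ℕ) :
    ∃ b : ℤ, (b : ℝ) = 2 ^ (17 * q) * padeDen p q (1 / 2) (7 / 2 ^ 15) :=
  exists_int_sum_half q p (fun k => (p + q - k).choose p)

theorem one_sub_rpow_neg_half : (1 - 7 / 2 ^ 15 : ℝ) ^ (-(1 / 2) : ℝ) = 2 ^ 7 * √2 / 181 := by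
  rw [Real.rpow_neg (by norm_num), ← Real.sqrt_eq_rpow]
  refine inv_eq_iff_eq_inv.2 ?_
  rw [Real.sqrt_eq_iff_mul_self_eq (by norm_num) (by positivity), inv_div]
  have h : √2 * √2 = 2 := Real.mul_self_sqrt (by norm_num)
  have h0 : √2 ≠ 0 := by positivity
  field_simp
  nlinarith

/-! ### Odd exponents, large j: numerical estimates and the contradiction. -/

/-- A single term of (2 + 5)^(7c) is at most the sum, and 7^7 / (2^2 · 5^5) < 66. -/
theorem choose_seven_five_le (c : ℕ) : (2 * c + 5 * c).choose (5 * c) ≤ 66 ^ c := by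
  have h : 2 ^ (2 * c) * 5 ^ (5 * c) * (2 * c + 5 * c).choose (2 * c) ≤ (2 + 5) ^ (2 * c + 5 * c) := by
    rw [add_pow]
    refine le_trans (le_of_eq ?_) (single_le_sum
      (f := fun k => 2 ^ k * 5 ^ (2 * c + 5 * c - k) * (2 * c + 5 * c).choose k)
      (fun _ _ => Nat.zero_le _) (mem_range.2 (by omega : 2 * c < 2 * c + 5 * c + 1)))
    simp only [Nat.add_sub_cancel_left]
  rw [Nat.choose_symm_add] at h
  have h1 : (2 + 5) ^ (2 * c + 5 * c) ≤ 2 ^ (2 * c) * 5 ^ (5 * c) * 66 ^ c := by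
    rw [← add_mul, pow_mul, pow_mul, pow_mul, ← mul_pow, ← mul_pow]
    exact Nat.pow_le_pow_left (by norm_num) c
  exact Nat.le_of_mul_le_mul_left (h.trans h1) (by positivity)

theorem cube_le_two_pow {c : ℕ} (hc : 10 ≤ c) : c ^ 3 ≤ 2 ^ c := by
  induction c, hc using Nat.le_induction with
  | base => norm_num
  | succ c hc ih =>
    rw [pow_succ 2]
    have h1 : 10 * c ^ 2 ≤ c ^ 3 := by
      rw [pow_succ c 2, mul_comm]
      exact Nat.mul_le_mul_left _ hc
    nlinarith

theorem abs_div_sub_sqrt_two_le {j : ℕ} {x D : ℤ} (hx : 0 ≤ x) (h : x ^ 2 = 2 ^ (2 * j + 1) + D) :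
    |(x : ℝ) / 2 ^ j - √2| ≤ |(D : ℝ)| / 4 ^ j := by
  have h2 : √2 * √2 = 2 := Real.mul_self_sqrt (by norm_num)
  have h1 : (1 : ℝ) ≤ √2 := Real.one_le_sqrt.2 (by norm_num)
  have hx' : (0 : ℝ) ≤ x := by exact_mod_cast hx
  have hR : (x : ℝ) ^ 2 = 2 * 4 ^ j + D := by
    have : (x : ℝ) ^ 2 = 2 ^ (2 * j + 1) + D := by exact_mod_cast h
    rw [this, pow_succ, pow_mul]
    norm_num
    ring
  have h4 : (4 : ℝ) ^ j = 2 ^ j * 2 ^ j := by rw [← mul_pow]; norm_num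
  have hpos : (0 : ℝ) < 2 ^ j := by positivity
  have hD : (D : ℝ) = 4 ^ j * ((x / 2 ^ j - √2) * (x / 2 ^ j + √2)) := by
    rw [h4] at hR ⊢
    field_simp
    linear_combination -hR + (2 ^ j) ^ 2 * h2
  rw [le_div_iff₀ (by positivity), hD, abs_mul, abs_of_pos (by positivity : (0 : ℝ) < 4 ^ j), abs_mul,
    mul_comm]
  have h5 : 1 ≤ |(x : ℝ) / 2 ^ j + √2| := by
    rw [abs_of_nonneg (by positivity)]
    have : 0 ≤ (x : ℝ) / 2 ^ j := by positivity
    linarith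
  exact mul_le_mul_of_nonneg_left (le_mul_of_one_le_right (abs_nonneg _) h5) (by positivity)

theorem remainder_bounds {c : ℕ} (hc : 0 < c) :
    181 * padeRem (2 * c) (5 * c) (1 / 2) (7 / 2 ^ 15) * 2 ^ (85 * c) ≤ 1 / 2 ∧
    181 * (7 / 2 ^ 15) * (823543 / 2 ^ 20) ^ c ≤ 8 * c * (7 * c + 1) * (2 * c + 5 * c).choose (5 * c) *
      (181 * padeRem (2 * c) (5 * c) (1 / 2) (7 / 2 ^ 15) * 2 ^ (85 * c)) := by
  obtain ⟨θ, hθ1, hθ2, hR⟩ := padeRem_eq (2 * c) (5 * c) (ν := 1 / 2) (z := 7 / 2 ^ 15)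
    (t := 7 / 2 ^ 15) (by norm_num) (by norm_num) (by norm_num) le_rfl
  have hκ1 := padeConst_half_le_one (2 * c) (5 * c) (by omega)
  have hκ2 := one_le_padeConst_half (2 * c) (5 * c) (by omega) (by omega)
  have hE : 181 * padeRem (2 * c) (5 * c) (1 / 2) (7 / 2 ^ 15) * 2 ^ (85 * c)
      = 181 * (7 / 2 ^ 15) * (823543 / 2 ^ 20) ^ c * (padeConst (2 * c) (5 * c) (1 / 2) * θ) := by
    -- Here 823543 = 7^7.
    have : (823543 / 2 ^ 20 : ℝ) = (7 / 2 ^ 15) ^ 7 * 2 ^ 85 := by norm_num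
    rw [hR, this, mul_pow, ← pow_mul, ← pow_mul, show 2 * c + 5 * c + 1 = 7 * c + 1 by ring,
      pow_succ]
    ring
  set κ := padeConst (2 * c) (5 * c) (1 / 2)
  have hC : (0 : ℝ) < 4 * (2 * c : ℕ) * ((2 * c : ℕ) + (5 * c : ℕ) + 1) *
      (2 * c + 5 * c).choose (5 * c) := by
    have : 0 < (2 * c + 5 * c).choose (5 * c) := Nat.choose_pos (by omega)
    positivity
  have hκ0 : 0 < κ := by
    by_contra hneg
    nlinarith [mul_nonneg hC.le (by linarith : 0 ≤ -κ)]
  rw [hE]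
  constructor
  · have hθ3 : θ ≤ ((1 - 7 / 2 ^ 15 : ℝ)⁻¹) ^ (5 * c + 2) := by
      refine hθ2.trans ?_
      rw [inv_pow, ← Real.rpow_natCast _ (5 * c + 2), ← Real.rpow_neg (by norm_num)]
      refine Real.rpow_le_rpow_of_exponent_ge (by norm_num) (by norm_num) ?_
      push_cast
      linarith
    have h1 : κ * θ ≤ ((1 - 7 / 2 ^ 15 : ℝ)⁻¹) ^ (5 * c + 2) :=
      (mul_le_of_le_one_left (by linarith) hκ1).trans hθ3
    calc 181 * (7 / 2 ^ 15) * (823543 / 2 ^ 20) ^ c * (κ * θ)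
        ≤ 181 * (7 / 2 ^ 15) * (823543 / 2 ^ 20) ^ c * ((1 - 7 / 2 ^ 15 : ℝ)⁻¹) ^ (5 * c + 2) := by
          gcongr
      _ = 181 * (7 / 2 ^ 15) * ((1 - 7 / 2 ^ 15 : ℝ)⁻¹) ^ 2 *
            (823543 / 2 ^ 20 * ((1 - 7 / 2 ^ 15 : ℝ)⁻¹) ^ 5) ^ c := by
          rw [mul_pow, ← pow_mul, pow_add]; ring
      _ ≤ 181 * (7 / 2 ^ 15) * ((1 - 7 / 2 ^ 15 : ℝ)⁻¹) ^ 2 * 1 := by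
          gcongr
          exact pow_le_one₀ (by norm_num) (by norm_num)
      _ ≤ 1 / 2 := by norm_num
  · have h1 : 1 ≤ 8 * c * (7 * c + 1) * (2 * c + 5 * c).choose (5 * c) * (κ * θ) := by
      rw [← mul_assoc]
      refine le_trans ?_ (le_mul_of_one_le_right (by positivity) hθ1)
      refine hκ2.trans (le_of_eq ?_)
      push_cast
      ring
    have h2 : (0 : ℝ) ≤ 181 * (7 / 2 ^ 15) * (823543 / 2 ^ 20) ^ c := by positivity
    nlinarith [mul_le_mul_of_nonneg_left h1 h2]

theorem error_bound {c j : ℕ} (hc : 34 ≤ c) (hj1 : j ≤ 51 * c + 7) (hj2 : 51 * c ≤ j + 43) :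
    8 * c * (7 * c + 1) * ((2 * c + 5 * c).choose (5 * c) : ℝ) *
      (2 ^ (85 * c + 7) * (16 * j / 4 ^ j) *
        ((2 * c + 5 * c).choose (5 * c) * (1 + 7 / 2 ^ 15) ^ (5 * c + 1)))
      < 181 * (7 / 2 ^ 15) * (823543 / 2 ^ 20) ^ c := by
  have hC : ((2 * c + 5 * c).choose (5 * c) : ℝ) ≤ 66 ^ c := by exact_mod_cast choose_seven_five_le c
  have hjr : (1 : ℝ) / 4 ^ j ≤ 2 ^ 86 / 2 ^ (102 * c) := by
    rw [div_le_div_iff₀ (by positivity) (by positivity), one_mul,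
      show (4 : ℝ) = 2 ^ 2 by norm_num, ← pow_mul, ← pow_add]
    exact pow_le_pow_right₀ (by norm_num) (by omega)
  have hpoly : 8 * (c : ℝ) * (7 * c + 1) * (16 * j) ≤ 2 ^ 16 * 2 ^ c := by
    have h1 : (c : ℝ) ^ 3 ≤ 2 ^ c := by exact_mod_cast cube_le_two_pow (by omega)
    have h2 : (j : ℝ) ≤ 52 * c := by exact_mod_cast (by omega : j ≤ 52 * c)
    have h3 : (7 * c + 1 : ℝ) ≤ 8 * c := by exact_mod_cast (by omega : 7 * c + 1 ≤ 8 * c)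
    calc 8 * (c : ℝ) * (7 * c + 1) * (16 * j) ≤ 8 * c * (8 * c) * (16 * (52 * c)) := by gcongr
      _ = 53248 * c ^ 3 := by ring
      _ ≤ 2 ^ 16 * 2 ^ c := by
        refine mul_le_mul (by norm_num) h1 (by positivity) (by positivity)
  have hZ : (1 + 7 / 2 ^ 15 : ℝ) ^ (5 * c + 1) ≤ 1.002 ^ c * 2 := by
    rw [pow_succ, pow_mul]
    gcongr <;> norm_num
  calc _ = (8 * c * (7 * c + 1) * (16 * j)) * 2 ^ (85 * c + 7) * (1 / 4 ^ j) *
        (((2 * c + 5 * c).choose (5 * c) : ℝ) ^ 2 * (1 + 7 / 2 ^ 15) ^ (5 * c + 1)) := by ring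
    _ ≤ (2 ^ 16 * 2 ^ c) * 2 ^ (85 * c + 7) * (2 ^ 86 / 2 ^ (102 * c)) *
        ((66 ^ c) ^ 2 * (1.002 ^ c * 2)) := by gcongr
    _ = 2 ^ 110 * (2 * 66 ^ 2 * 1.002 / 2 ^ 17) ^ c := by
        rw [div_pow, mul_pow, mul_pow, ← pow_mul 66, ← pow_mul 66, mul_comm c 2,
          show 102 * c = 85 * c + 17 * c by ring, pow_add _ (85 * c), pow_add _ (85 * c), ← pow_mul 2 17]
        field_simp
    _ ≤ 2 ^ 110 * (1 / 11 * (823543 / 2 ^ 20)) ^ c := by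
        gcongr
        norm_num
    _ = 2 ^ 110 * (1 / 11) ^ c * (823543 / 2 ^ 20) ^ c := by rw [mul_pow]; ring
    -- The condition c ≥ 34 is what brings 2^110 / 11^c below 181 · 7 / 2^15.
    _ ≤ 2 ^ 110 * (1 / 11) ^ 34 * (823543 / 2 ^ 20) ^ c := by
        gcongr ?_ * ?_ * _
        exact pow_le_pow_of_le_one (by norm_num) (by norm_num) hc
    _ < _ := by
        refine mul_lt_mul_of_pos_right ?_ (by positivity)
        norm_num

theorem sq_ne_two_pow_add_of_large {j : ℕ} {x D : ℤ} (hj : 1691 ≤ j) (hx : 0 ≤ x)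
    (hD : |D| ≤ 16 * j) : x ^ 2 ≠ 2 ^ (2 * j + 1) + D := by
  intro h
  obtain ⟨c, hc, hj1, hj2⟩ : ∃ c, 34 ≤ c ∧ j ≤ 51 * c + 7 ∧ 51 * c ≤ j + 43 :=
    -- The least c with j ≤ 51c + 7; j = 1691 gives exactly c = 34.
    ⟨(j + 43) / 51, by omega, by omega, by omega⟩
  obtain ⟨a, ha⟩ := exists_int_padeNum (2 * c) (5 * c)
  obtain ⟨b, hb⟩ := exists_int_padeDen (2 * c) (5 * c)
  obtain ⟨hε1, hε2⟩ := remainder_bounds (c := c) (by omega)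
  have hη := error_bound hc hj1 hj2
  have hδ := abs_div_sub_sqrt_two_le hx h
  have hA := abs_padeNum_half_le (2 * c) (5 * c) (by omega) (t := 7 / 2 ^ 15) (by norm_num)
  set C : ℝ := ((2 * c + 5 * c).choose (5 * c) : ℝ)
  set ε := 181 * padeRem (2 * c) (5 * c) (1 / 2) (7 / 2 ^ 15) * 2 ^ (85 * c) with hε
  set A := padeNum (2 * c) (5 * c) (1 / 2) (7 / 2 ^ 15)
  have hC : 0 < 8 * c * (7 * c + 1) * C := by
    have : 0 < (2 * c + 5 * c).choose (5 * c) := Nat.choose_pos (by omega)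
    have : 0 < C := Nat.cast_pos.2 this
    have : (0 : ℝ) < c := by exact_mod_cast (by omega : 0 < c)
    positivity
  have hsmall : |2 ^ (85 * c + 7) * ((x : ℝ) / 2 ^ j - √2) * A| < ε := by
    refine lt_of_mul_lt_mul_left (lt_of_le_of_lt ?_ (hη.trans_le hε2)) hC.le
    refine mul_le_mul_of_nonneg_left ?_ hC.le
    have hD' : |(D : ℝ)| ≤ 16 * j := by exact_mod_cast hD
    rw [abs_mul, abs_mul, abs_of_pos (by positivity : (0 : ℝ) < 2 ^ (85 * c + 7))]
    have : |(x : ℝ) / 2 ^ j - √2| ≤ 16 * j / 4 ^ j := hδ.trans (by gcongr)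
    gcongr
  have hL : ((2 ^ (51 * c + 7 - j) * x * a - 181 * b : ℤ) : ℝ)
      = ε + 2 ^ (85 * c + 7) * ((x : ℝ) / 2 ^ j - √2) * A := by
    have e1 : (2 : ℝ) ^ (51 * c + 7 - j) = 2 ^ (51 * c + 7) / 2 ^ j :=
      pow_sub₀ 2 (by norm_num) hj1 |>.trans (div_eq_mul_inv _ _).symm
    rw [hε, padeRem, one_sub_rpow_neg_half]
    push_cast
    rw [ha, hb, e1, show 17 * (2 * c) = 34 * c by ring, show 17 * (5 * c) = 85 * c by ring,
      show 85 * c + 7 = 51 * c + 34 * c + 7 by ring, show 85 * c = 51 * c + 34 * c by ring]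
    simp only [pow_add]
    ring
  obtain ⟨h1, h2⟩ := abs_lt.1 hsmall
  have hpos : (0 : ℝ) < ((2 ^ (51 * c + 7 - j) * x * a - 181 * b : ℤ) : ℝ) := by
    rw [hL]; linarith
  have hlt : ((2 ^ (51 * c + 7 - j) * x * a - 181 * b : ℤ) : ℝ) < 1 := by
    rw [hL]; linarith
  have h3 := Int.cast_pos.1 hpos
  have h4 : 2 ^ (51 * c + 7 - j) * x * a - 181 * b < 1 := by exact_mod_cast hlt
  omega

/-! ### Odd exponents, small j: verified computation. -/

/-- Checks that no square lies within `16 * (i - 1)` of `2 ^ (2 * i + 1) + 1` for the `fuel` many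
exponents `i` from `j` on, where `s` is the integer part of `√(2 ^ (2 * j + 1))`. The match
on `s` makes the kernel evaluate it at each step. -/
def noSquareNear : ℕ → ℕ → ℕ → Bool
  | 0, _, _ => true
  | _ + 1, _, 0 => false
  | fuel + 1, j, s + 1 =>
    Nat.blt ((s + 1) * (s + 1) + 16 * (j - 1)) (2 ^ (2 * j + 1) + 1) &&
    (Nat.blt (2 ^ (2 * j + 1) + 1 + 16 * (j - 1)) ((s + 2) * (s + 2)) &&
    noSquareNear fuel (j + 1)
      (bif Nat.ble ((2 * s + 3) * (2 * s + 3)) (2 ^ (2 * j + 3)) then 2 * s + 3 else 2 * s + 2))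

/-- The two comparisons already trap the interval between consecutive squares, so `s` need not be
known to be the integer square root. -/
theorem exists_of_noSquareNear {fuel j s : ℕ} (h : noSquareNear fuel j s = true) {i : ℕ}
    (hji : j ≤ i) (hi : i < j + fuel) :
    ∃ r : ℕ, r * r + 16 * (i - 1) < 2 ^ (2 * i + 1) + 1 ∧
      2 ^ (2 * i + 1) + 1 + 16 * (i - 1) < (r + 1) * (r + 1) := by
  induction fuel generalizing j s with
  | zero => omega
  | succ fuel ih =>
    cases s with
    | zero => simp [noSquareNear] at h
    | succ s =>
      rw [noSquareNear, Bool.and_eq_true, Bool.and_eq_true] at h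
      obtain ⟨h1, h2, h3⟩ := h
      rcases hji.eq_or_lt with rfl | hlt
      · exact ⟨s + 1, Nat.blt_eq ▸ h1, Nat.blt_eq ▸ h2⟩
      · exact ih h3 hlt (by omega)

theorem noSquareNear_ten : noSquareNear 1681 10 1448 = true := by decide +kernel

theorem sq_ne_of_lt_of_lt {r x v : ℤ} (hr : 0 ≤ r) (hx : 0 ≤ x) (h1 : r * r < v)
    (h2 : v < (r + 1) * (r + 1)) : x ^ 2 ≠ v := by
  rintro rfl
  have h3 : r < x := by nlinarith
  have h4 : x < r + 1 := by nlinarith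
  omega

theorem sq_ne_two_pow_add {j : ℕ} {x : ℤ} (hj : 3 ≤ j) (hx : 0 ≤ x) :
    x ^ 2 ≠ 2 ^ (2 * j + 1) + (1 + 16 * (j - 1)) ∧ x ^ 2 ≠ 2 ^ (2 * j + 1) + (1 - 16 * (j - 1)) := by
  rcases le_or_gt 1691 j with h | h
  · exact ⟨sq_ne_two_pow_add_of_large h hx (abs_le.2 ⟨by omega, by omega⟩),
      sq_ne_two_pow_add_of_large h hx (abs_le.2 ⟨by omega, by omega⟩)⟩
  rcases le_or_gt 10 j with h10 | h10
  · obtain ⟨r, h1, h2⟩ := exists_of_noSquareNear noSquareNear_ten h10 (by omega)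
    zify [show 1 ≤ j by omega] at h1 h2
    have hj' : (1 : ℤ) ≤ j := by omega
    exact ⟨sq_ne_of_lt_of_lt (Int.natCast_nonneg r) hx (by linarith) (by linarith),
      sq_ne_of_lt_of_lt (Int.natCast_nonneg r) hx (by linarith) (by linarith)⟩
  -- For j = 9 the square 724² lies in the interval used above, so for j < 10 only the two actual
  -- values are tested.
  have hsq : ∀ v : ℤ, ¬ IsSquare v → x ^ 2 ≠ v := fun v hv hxv => hv ⟨x, by rw [← hxv, sq]⟩
  constructor <;> refine hsq _ ?_ <;> interval_cases j <;> norm_num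

/-! ### Even exponents and the conclusion. -/

theorem eight_mul_lt_two_pow {k : ℕ} (hk : 5 ≤ k) : 8 * (2 * k - 3) < 2 ^ (k + 1) := by
  induction k, hk using Nat.le_induction with
  | base => norm_num
  | succ k hk ih =>
    rw [pow_succ]
    omega

theorem sq_ne_two_pow_even_add {k : ℕ} {x : ℤ} (hk : 3 ≤ k) (hx : 0 ≤ x) :
    x ^ 2 ≠ 2 ^ (2 * k) + (1 + 8 * (2 * k - 3)) ∧ x ^ 2 ≠ 2 ^ (2 * k) + (1 - 8 * (2 * k - 3)) := by
  rcases le_or_gt 5 k with h | h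
  · have h1 := eight_mul_lt_two_pow h
    zify [show 3 ≤ 2 * k by omega] at h1
    have h2 : (2 : ℤ) ^ (2 * k) = 2 ^ k * 2 ^ k := by rw [← pow_add]; congr 1; ring
    have h3 : (0 : ℤ) < 2 ^ k := by positivity
    have h4 : (5 : ℤ) ≤ k := by exact_mod_cast h
    rw [pow_succ] at h1
    constructor
    · exact sq_ne_of_lt_of_lt h3.le hx (by nlinarith) (by nlinarith)
    -- With the minus sign the value falls just below (2^k)².
    · exact sq_ne_of_lt_of_lt (r := 2 ^ k - 1) (by omega) hx (by nlinarith) (by nlinarith)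
  have hsq : ∀ v : ℤ, ¬ IsSquare v → x ^ 2 ≠ v := fun v hv hxv => hv ⟨x, by rw [← hxv, sq]⟩
  constructor <;> refine hsq _ ?_ <;> interval_cases k <;> norm_num

theorem sq_ne_two_pow_add_eight_mul {n : ℕ} {x : ℤ} (hn : 3 ≤ n) (hx : 0 ≤ x) :
    x ^ 2 ≠ 2 ^ (n + 3) + (1 + 8 * n) ∧ x ^ 2 ≠ 2 ^ (n + 3) + (1 - 8 * n) := by
  rcases Nat.even_or_odd' n with ⟨i, rfl | rfl⟩
  · have h := sq_ne_two_pow_add (j := i + 1) (x := x) (by omega) hx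
    rw [show 2 * (i + 1) + 1 = 2 * i + 3 by ring] at h
    push_cast at h ⊢
    convert h using 4 <;> ring
  · have h := sq_ne_two_pow_even_add (k := i + 2) (x := x) (by omega) hx
    rw [show 2 * (i + 2) = 2 * i + 1 + 3 by ring] at h
    push_cast at h ⊢
    convert h using 4 <;> ring

theorem theorem1 (n m : ℤ) (hn : 2 < n) (hm : 0 ≤ m) :
    (2 : ℚ) ^ n + (n : ℚ) ≠ (m : ℚ) * ((m : ℚ) + 1) / 2 ∧
      (2 : ℚ) ^ n - (n : ℚ) ≠ (m : ℚ) * ((m : ℚ) + 1) / 2 := by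
  lift n to ℕ using by omega
  obtain ⟨h1, h2⟩ := sq_ne_two_pow_add_eight_mul (n := n) (x := 2 * m + 1) (by omega) (by omega)
  rw [zpow_natCast, Int.cast_natCast]
  constructor
  · intro h
    apply h1
    have : ((2 * m + 1 : ℚ)) ^ 2 = 2 ^ (n + 3) + (1 + 8 * n) := by
      rw [pow_add]; linear_combination -8 * h
    exact_mod_cast this
  · intro h
    apply h2
    have : ((2 * m + 1 : ℚ)) ^ 2 = 2 ^ (n + 3) + (1 - 8 * n) := by
      rw [pow_add]; linear_combination -8 * h
    exact_mod_cast this
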